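/- Let $G$ be a finite simple bipartite graph with bipartition $(X,Y)$. Two edges of a bipartite graph are *independent* if they are disjoint and no edge of the graph joins an end of one to an end of the other. The *independence graph* $I(G)$ has the edges of $G$ as its vertices, two of them being adjacent if and only if they are independent in $G$. Then the following statements are equivalent: (i) $I(G)$ is a comparability graph, i.e. it has a transitive orientation; (ii) the complement $\overline{G}$ has a $T$-free orientation; (iii) $G$ does not contain an invertible pair; (iv) $G$ does not contain a weak edge-asteroid; (v) $G$ does not contain an edge-asteroid; (vi) the complement $\overline{I(G)}$ does not contain an asteroid. Here the following definitions are used. - The *bipartite complement* $G'$ of $G$ has the same vertices and the same bipartition $(X,Y)$, and $xy$ with $x\in X$, $y\in Y$ is an edge of $G'$ if and only if it is not an edge of $G$. An *orientation of* $\overline{G}$ is a mixed graph in which every edge of $\overline{G}$ inside $X$ or inside $Y$ is given exactly one direction, and the edges of $\overline{G}$ between $X$ and $Y$ (the edges of $G'$) remain undirected. It is *$T$-free* if there are no edges $xy, x'y'$ of $G'$ ($x,x'\in X$, $y,y'\in Y$) independent in $G'$ such that $x\to x'$ and $y\to y'$, or $x'\to x$ and $y'\to y$. - Two walks in $G$ that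 both begin in $X$ or both begin in $Y$ are *congruent* if they have the same length and, for each $i$, their $i$-th edges are independent in $G$. An *invertible pair* is a pair of distinct vertices $u,v$ for which there exist congruent walks $W,W'$ such that $W$ goes from $u$ to $v$ and $W'$ goes from $v$ to $u$. - A *weak edge-asteroid* in $G$ consists of edges $e_0,e_1,\dots,e_{2k}$ of $G$ ($k \ge 0$), not necessarily distinct, such that for each $i=0,1,\dots,2k$ there is a walk in $G$ joining $e_{i+k}$ and $e_{i+k+1}$, containing both ends of $e_{i+k}$ and both ends of $e_{i+k+1}$, that contains no vertex adjacent to either end of $e_i$ (subscripts modulo $2k+1$). It is an *edge-asteroid* if the edges $e_0,\dots,e_{2k}$ are distinct. - An *asteroid* in a graph consists of distinct vertices $v_0,v_1,\dots,v_{2k}$, $k\ge 1$, such that for each $i=0,1,\dots,2k$ there is a path joining $v_{i+k}$ and $v_{i+k+1}$ none of whose vertices is a neighbour of $v_i$ (subscripts modulo $2k+1$). -/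

import Mathlib

namespace Bigraph

variable {V : Type*}

/-- `H` is a comparability graph: it has a transitive orientation `r`, i.e. every edge gets exactly
one of its two directions, nothing else is oriented, and `r` is transitive. -/
def IsComparabilityGraph (H : SimpleGraph V) : Prop :=
  ∃ r : V → V → Prop,
    (∀ a b, H.Adj a b ↔ r a b ∨ r b a) ∧
    (∀ a b, r a b → ¬ r b a) ∧
    (∀ a b c, r a b → r b c → r a c)

/-- `H` contains an asteroid: distinct vertices `v 0, …, v (2k)`, `k ≥ 1`, such that for each `i`
there is a path joining `v (i+k)` and `v (i+k+1)` with no vertex a neighbour of `v i`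
(indices modulo `2k+1`). -/
def HasAsteroid (H : SimpleGraph V) : Prop :=
  ∃ k : ℕ, 1 ≤ k ∧ ∃ v : ZMod (2 * k + 1) → V, Function.Injective v ∧
    ∀ i, ∃ p : H.Walk (v (i + k)) (v (i + k + 1)),
      p.IsPath ∧ ∀ u ∈ p.support, ¬ H.Adj (v i) u

/-- Two edges of `G` are independent: they are disjoint and no edge of `G` joins an end of one to an
end of the other. -/
def Independent (G : SimpleGraph V) (e f : Sym2 V) : Prop :=
  e ∈ G.edgeSet ∧ f ∈ G.edgeSet ∧ ∀ a ∈ e, ∀ b ∈ f, a ≠ b ∧ ¬ G.Adj a b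

theorem Independent.symm {G : SimpleGraph V} {e f : Sym2 V} (h : Independent G e f) :
    Independent G f e :=
  ⟨h.2.1, h.1, fun a ha b hb =>
    ⟨fun hab => (h.2.2 b hb a ha).1 hab.symm, fun hab => (h.2.2 b hb a ha).2 hab.symm⟩⟩

/-- For edges `xy`, `x'y'` written along a bipartition, independence means: disjoint, and neither
`xy'` nor `x'y` is an edge. -/
theorem independent_mk_iff {G : SimpleGraph V} {X Y : Set V} (hG : G.IsBipartiteWith X Y)
    {x x' y y' : V} (hx : x ∈ X) (hx' : x' ∈ X) (hy : y ∈ Y) (hy' : y' ∈ Y) :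
    Independent G s(x, y) s(x', y') ↔
      G.Adj x y ∧ G.Adj x' y' ∧ x ≠ x' ∧ y ≠ y' ∧ ¬ G.Adj x y' ∧ ¬ G.Adj x' y := by
  have hd : ∀ {a b}, a ∈ X → b ∈ Y → a ≠ b := fun ha hb h =>
    Set.disjoint_left.mp hG.disjoint ha (h ▸ hb)
  have hXX : ∀ {a b}, a ∈ X → b ∈ X → ¬ G.Adj a b := fun ha hb h => by
    rcases hG.mem_of_adj h with h | h
    · exact hd hb h.2 rfl
    · exact hd ha h.1 rfl
  have hYY : ∀ {a b}, a ∈ Y → b ∈ Y → ¬ G.Adj a b := fun ha hb h => by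
    rcases hG.mem_of_adj h with h | h
    · exact hd h.1 ha rfl
    · exact hd h.2 hb rfl
  have h1 := hXX hx hx'
  have h2 := hYY hy hy'
  have h3 := hd hx hy'
  have h4 := (hd hx' hy).symm
  simp only [Independent, SimpleGraph.mem_edgeSet, Sym2.mem_iff, forall_eq_or_imp, forall_eq,
    G.adj_comm y x']
  tauto

/-- The independence graph `I(G)`: its vertices are the edges of `G`, adjacent iff independent. -/
def independenceGraph (G : SimpleGraph V) : SimpleGraph G.edgeSet where
  Adj e f := Independent G e f
  symm := ⟨fun _ _ h => h.symm⟩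
  loopless := ⟨fun e h => by
    obtain ⟨e, he⟩ := e
    induction e with
    | _ a b => exact (h.2.2 a (Sym2.mem_mk_left a b) a (Sym2.mem_mk_left a b)).1 rfl⟩

/-- A walk joining the edges `e` and `f`: it starts at an end of `e`, finishes at an end of `f` and
contains both ends of `e` and both ends of `f`; moreover none of its vertices is adjacent to an end
of `d`. -/
def EdgesJoinedAvoiding (G : SimpleGraph V) (e f d : Sym2 V) : Prop :=
  ∃ a ∈ e, ∃ b ∈ f, ∃ p : G.Walk a b,
    (∀ u ∈ e, u ∈ p.support) ∧ (∀ u ∈ f, u ∈ p.support) ∧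
    ∀ u ∈ p.support, ∀ w ∈ d, ¬ G.Adj u w

/-- `G` contains a weak edge-asteroid: edges `e 0, …, e (2k)`, not necessarily distinct, such that
for each `i` there is a walk joining `e (i+k)` and `e (i+k+1)` with no vertex adjacent to an end of
`e i` (indices modulo `2k+1`). For `k = 0` this is impossible. -/
def HasWeakEdgeAsteroid (G : SimpleGraph V) : Prop :=
  ∃ (k : ℕ) (e : ZMod (2 * k + 1) → Sym2 V), (∀ i, e i ∈ G.edgeSet) ∧
    ∀ i, EdgesJoinedAvoiding G (e (i + k)) (e (i + k + 1)) (e i)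

/-- `G` contains an edge-asteroid: as above, with distinct edges. -/
def HasEdgeAsteroid (G : SimpleGraph V) : Prop :=
  ∃ (k : ℕ) (e : ZMod (2 * k + 1) → Sym2 V), Function.Injective e ∧ (∀ i, e i ∈ G.edgeSet) ∧
    ∀ i, EdgesJoinedAvoiding G (e (i + k)) (e (i + k + 1)) (e i)

/-- `a` and `b` lie in the same part of the bipartition `(X, Y)`. -/
def SamePart (X Y : Set V) (a b : V) : Prop :=
  (a ∈ X ∧ b ∈ X) ∨ (a ∈ Y ∧ b ∈ Y)

/-- Two walks are congruent: both begin in `X` or both begin in `Y`, they have the same length, and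
for each `i` their `i`-th edges are independent. -/
def Congruent (G : SimpleGraph V) (X Y : Set V) {a b c d : V} (W : G.Walk a b) (W' : G.Walk c d) :
    Prop :=
  SamePart X Y a c ∧ W.length = W'.length ∧
    ∀ i < W.length,
      Independent G s(W.getVert i, W.getVert (i + 1)) s(W'.getVert i, W'.getVert (i + 1))

/-- `G` contains an invertible pair: distinct `u`, `v` for which there are congruent walks, one from
`u` to `v` and one from `v` to `u`. -/
def HasInvertiblePair (G : SimpleGraph V) (X Y : Set V) : Prop :=
  ∃ u v : V, u ≠ v ∧ ∃ (W : G.Walk u v) (W' : G.Walk v u), Congruent G X Y W W'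

/-- The bipartite complement of `G` with respect to `(X, Y)`. -/
def bipartiteComplement (G : SimpleGraph V) (X Y : Set V) : SimpleGraph V where
  Adj a b := a ≠ b ∧ ((a ∈ X ∧ b ∈ Y) ∨ (a ∈ Y ∧ b ∈ X)) ∧ ¬ G.Adj a b
  symm := ⟨fun _ _ h => ⟨h.1.symm, h.2.1.symm.imp And.symm And.symm, fun h' => h.2.2 h'.symm⟩⟩
  loopless := ⟨fun _ h => h.1 rfl⟩

/-- An orientation of the complement of `G`: the edges of `Gᶜ` inside `X` and inside `Y` are
oriented (each in exactly one direction); the edges of `Gᶜ` between `X` and `Y`, that is the edges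
of the bipartite complement, stay undirected. The mixed graph is given by its set `arc` of directed
edges. -/
structure IsComplementOrientation (G : SimpleGraph V) (X Y : Set V) (arc : V → V → Prop) :
    Prop where
  arc_mem : ∀ a b, arc a b → Gᶜ.Adj a b ∧ SamePart X Y a b
  oriented : ∀ a b, Gᶜ.Adj a b → SamePart X Y a b → arc a b ∨ arc b a
  asymm : ∀ a b, arc a b → ¬ arc b a

/-- `Gᶜ` has a `T`-free orientation: one in which no two edges `xy`, `x'y'` (`x, x' ∈ X`,
`y, y' ∈ Y`) that are independent in the bipartite complement agree, i.e. have both `xx'`, `yy'` or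
both `x'x`, `y'y` as directed edges. -/
def HasTFreeOrientation (G : SimpleGraph V) (X Y : Set V) : Prop :=
  ∃ arc : V → V → Prop, IsComplementOrientation G X Y arc ∧
    ∀ x ∈ X, ∀ x' ∈ X, ∀ y ∈ Y, ∀ y' ∈ Y,
      Independent (bipartiteComplement G X Y) s(x, y) s(x', y') →
        ¬ ((arc x x' ∧ arc y y') ∨ (arc x' x ∧ arc y' y))

end Bigraph

/-! All six conditions are compared with one: in `H = I(G)` no ordered adjacent pair forces its own
reversal (`ForcingConsistent`). By Gallai's theory this is (i): a transitive orientation respects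
forcing, and conversely, when forcing is consistent, a well-order picks a direction for each forcing
class and the triangle lemma excludes cyclic triangles.

Inconsistency amounts to an odd closed walk in Gallai's knotting graph. Its vertices are pairs of a
vertex `v` and a component of the complement of `H` on the `H`-neighbours of `v`; an edge joins `u`
with the component of `v` to `v` with the component of `u`. Reindexed, such a walk is a weak
asteroid. The hard point is that a shortest one repeats no vertex of `H`
(`IsKnotCycle.dvd_sub_of_eq`), so it is an asteroid. In `I(G)` the components translate into walks
of `G` (`linked_independenceGraph_iff`), which gives (iv), (v) and (vi).

For (ii) and (iii), congruent walks lift to forcing in `I(G)`, so an invertible pair destroys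
consistency. Without invertible pairs, choosing a direction for each class of vertex pairs linked by
congruent walks is T-free. A T-free orientation, read on the ends in `X`, orients `I(G)` compatibly
with forcing. -/

namespace Bigraph

variable {V : Type*} {H : SimpleGraph V}

/-! ### Components of the complement, and forcing -/

/-- `x` and `y` lie in the same component of the subgraph that the complement of `H` induces
on `S`. -/
inductive CoJoined (H : SimpleGraph V) (S : Set V) (x : V) : V → Prop
  | refl : x ∈ S → CoJoined H S x x
  | tail {y z : V} : CoJoined H S x y → ¬ H.Adj y z → z ∈ S → CoJoined H S x z

namespace CoJoined

variable {S T : Set V} {x y z : V}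

theorem mem_left (h : CoJoined H S x y) : x ∈ S := by
  induction h with
  | refl h => exact h
  | tail _ _ _ ih => exact ih

theorem mem_right (h : CoJoined H S x y) : y ∈ S := by
  cases h with
  | refl h => exact h
  | tail _ _ h => exact h

theorem trans (h : CoJoined H S x y) (h' : CoJoined H S y z) : CoJoined H S x z := by
  induction h' with
  | refl _ => exact h
  | tail _ h1 h2 ih => exact ih.tail h1 h2

theorem single (hx : x ∈ S) (h : ¬ H.Adj x y) (hy : y ∈ S) : CoJoined H S x y :=
  (refl hx).tail h hy

theorem symm (h : CoJoined H S x y) : CoJoined H S y x := by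
  induction h with
  | refl h => exact refl h
  | tail h0 h1 h2 ih => exact (single h2 (fun h => h1 h.symm) h0.mem_right).trans ih

theorem mono (hST : S ⊆ T) (h : CoJoined H S x y) : CoJoined H T x y := by
  induction h with
  | refl h => exact refl (hST h)
  | tail _ h1 h2 ih => exact ih.tail h1 (hST h2)

/-- Allows `S` to be replaced by any set that contains the component. -/
theorem within (h : CoJoined H S x y) : CoJoined H {u | CoJoined H S x u} x y := by
  induction h with
  | refl h => exact refl (refl h)
  | tail h0 h1 h2 ih => exact ih.tail h1 (h0.tail h1 h2)

end CoJoined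

/-- `x` and `y` lie in the same component of the complement of `H` after deleting `v` and its
neighbours there. -/
abbrev Linked (H : SimpleGraph V) (v : V) : V → V → Prop :=
  CoJoined H (H.neighborSet v)

/-- The forcing relation between ordered adjacent pairs: a transitive orientation that orients
`a` to `b` orients `c` to `d`. -/
inductive Forces (H : SimpleGraph V) (a b : V) : V → V → Prop
  | refl : H.Adj a b → Forces H a b a b
  | right {c d d' : V} : Forces H a b c d → H.Adj c d' → ¬ H.Adj d d' → Forces H a b c d'
  | left {c c' d : V} : Forces H a b c d → H.Adj c' d → ¬ H.Adj c c' → Forces H a b c' d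

namespace Forces

variable {a b c d e f : V}

theorem adj_left (h : Forces H a b c d) : H.Adj a b := by
  induction h with
  | refl h => exact h
  | right _ _ _ ih => exact ih
  | left _ _ _ ih => exact ih

theorem adj_right (h : Forces H a b c d) : H.Adj c d := by
  cases h with
  | refl h => exact h
  | right _ h _ => exact h
  | left _ h _ => exact h

theorem trans (h : Forces H a b c d) (h' : Forces H c d e f) : Forces H a b e f := by
  induction h' with
  | refl _ => exact h
  | right _ h1 h2 ih => exact ih.right h1 h2
  | left _ h1 h2 ih => exact ih.left h1 h2

theorem symm (h : Forces H a b c d) : Forces H c d a b := by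
  induction h with
  | refl h => exact refl h
  | right h0 h1 h2 ih => exact ((refl h1).right h0.adj_right (fun h => h2 h.symm)).trans ih
  | left h0 h1 h2 ih => exact ((refl h1).left h0.adj_right (fun h => h2 h.symm)).trans ih

theorem swap (h : Forces H a b c d) : Forces H b a d c := by
  induction h with
  | refl h => exact refl h.symm
  | right _ h1 h2 ih => exact ih.left h1.symm h2
  | left _ h1 h2 ih => exact ih.right h1.symm h2

/-- The triangle lemma for forcing classes. -/
theorem triangle {b' c' : V} (hab : H.Adj a b) (hac : H.Adj a c) (h₁ : ¬ Forces H b c b a)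
    (h₂ : ¬ Forces H b c a c) (h : Forces H b c b' c') :
    Forces H a b a b' ∧ Forces H a c a c' := by
  induction h with
  | refl _ => exact ⟨refl hab, refl hac⟩
  | @right x y z h hxz hyz ih =>
    -- Were `a`, `z` non-adjacent, `xz` would force `xa`, the reverse of a pair forced by `ab`; so
    -- `bc` would force `ba`.
    refine ⟨ih.1, ih.2.right (not_not.1 fun haz => h₁ ?_) hyz⟩
    exact ((h.right hxz hyz).right ih.1.adj_right.symm fun h => haz h.symm).trans ih.1.swap.symm
  | @left x z y h hzy hxz ih =>
    refine ⟨ih.1.right (not_not.1 fun haz => h₂ ?_) hxz, ih.2⟩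
    exact ((h.left hzy hxz).left ih.2.adj_right fun h => haz h.symm).trans ih.2.symm

end Forces

theorem Linked.forces {v x y : V} (h : Linked H v x y) : Forces H v x v y := by
  induction h with
  | refl h => exact .refl h
  | tail _ h1 h2 ih => exact ih.right h2 h1

/-- An orientation of `H` (antisymmetric and total on adjacent pairs) that orients both edges of
an induced path `b a c` out of `a`, or both into `a`, is compatible with forcing. -/
theorem Forces.orient {r : V → V → Prop} (htot : ∀ a b, H.Adj a b → r a b ∨ r b a)
    (hasymm : ∀ a b, H.Adj a b → r a b → ¬ r b a)
    (hr : ∀ a b c, H.Adj a b → H.Adj a c → ¬ H.Adj b c → r a b → r a c)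
    {a b c d : V} (h : Forces H a b c d) (hab : r a b) : r c d := by
  induction h with
  | refl _ => exact hab
  | right h0 h1 h2 ih => exact hr _ _ _ h0.adj_right h1 h2 ih
  | left h0 h1 h2 ih =>
    refine (htot _ _ h1).resolve_right fun h => hasymm _ _ h0.adj_right ih ?_
    exact hr _ _ _ h1.symm h0.adj_right.symm (fun h => h2 h.symm) h

/-- No adjacent pair is forced to be oriented in both directions. -/
def ForcingConsistent (H : SimpleGraph V) : Prop :=
  ∀ a b, ¬ Forces H a b b a

/-- `r` need not be transitive: compatibility on induced paths suffices, and this is what a T-free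
orientation provides. -/
theorem ForcingConsistent.of_orientation {r : V → V → Prop}
    (htot : ∀ a b, H.Adj a b → r a b ∨ r b a) (hasymm : ∀ a b, H.Adj a b → r a b → ¬ r b a)
    (hr : ∀ a b c, H.Adj a b → H.Adj a c → ¬ H.Adj b c → r a b → r a c) :
    ForcingConsistent H := by
  intro a b h
  rcases htot _ _ h.adj_left with h' | h'
  · exact hasymm _ _ h.adj_left h' (h.orient htot hasymm hr h')
  · exact hasymm _ _ h.adj_right h' (h.swap.orient htot hasymm hr h')

theorem IsComparabilityGraph.forcingConsistent (h : IsComparabilityGraph H) :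
    ForcingConsistent H := by
  obtain ⟨r, hadj, hasymm, htrans⟩ := h
  refine .of_orientation (r := r) (fun a b => (hadj a b).1) (fun a b _ => hasymm a b) ?_
  intro a b c _ hac hbc hr
  refine ((hadj a c).1 hac).resolve_right fun h => hbc ?_
  exact (hadj b c).2 (Or.inr (htrans _ _ _ h hr))

/-! ### Transitive orientation from consistent forcing -/

section Selected

variable {P : Type*} {lt : P → P → Prop} {R : P → P → Prop} {s : P → P}

/-- The class of `p` has an element that precedes the whole class of `s p`. -/
def Selected (lt R : P → P → Prop) (s : P → P) (p : P) : Prop :=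
  ∃ d, R p d ∧ ∀ d', R (s p) d' → lt d d'

/-- The least element of the union of the two classes decides which class is selected. -/
theorem selected_or [IsWellOrder P lt] {p : P} (hp : R p p) (hs : s (s p) = p)
    (hd : ∀ d, R p d → ¬ R (s p) d) : Selected lt R s p ∨ Selected lt R s (s p) := by
  have wf : WellFounded lt := IsWellFounded.wf
  obtain ⟨m, hm, hmin⟩ := wf.has_min {d | R p d ∨ R (s p) d} ⟨p, Or.inl hp⟩
  have key : ∀ d, R p d ∨ R (s p) d → d ≠ m → lt m d := fun d hd hne => by
    rcases trichotomous_of lt d m with h | h | h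
    · exact (hmin d hd h).elim
    · exact (hne h).elim
    · exact h
  rcases hm with hm | hm
  · exact Or.inl ⟨m, hm, fun d h => key d (Or.inr h) fun e => hd m hm (e ▸ h)⟩
  · refine Or.inr ⟨m, hm, fun d h => ?_⟩
    rw [hs] at h
    exact key d (Or.inl h) fun e => hd m (e ▸ h) hm

theorem Selected.not_swap [IsWellOrder P lt] {p : P} (hs : s (s p) = p)
    (h : Selected lt R s p) : ¬ Selected lt R s (s p) := by
  rintro ⟨d', h1, h2⟩
  obtain ⟨d, h3, h4⟩ := h
  rw [hs] at h2
  exact asymm_of lt (h4 d' h1) (h2 d h3)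

theorem Selected.congr {p q : P} (h : Selected lt R s p) (hpq : ∀ d, R p d → R q d)
    (hs : ∀ d, R (s q) d → R (s p) d) : Selected lt R s q := by
  obtain ⟨d, h1, h2⟩ := h
  exact ⟨d, hpq d h1, fun d' h => h2 d' (hs d' h)⟩

end Selected

/-- The lexicographic orientation of a graph with consistent forcing is transitive. -/
theorem ForcingConsistent.isComparabilityGraph (hH : ForcingConsistent H) :
    IsComparabilityGraph H := by
  let lt : V × V → V × V → Prop := Prod.Lex WellOrderingRel WellOrderingRel
  let R : V × V → V × V → Prop := fun p q => Forces H p.1 p.2 q.1 q.2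
  let r : V → V → Prop := fun a b => Selected lt R Prod.swap (a, b)
  have : IsWellOrder (V × V) lt := inferInstanceAs (IsWellOrder _ (Prod.Lex _ _))
  have hadj : ∀ {a b}, r a b → H.Adj a b := fun ⟨_, h, _⟩ => h.adj_left
  have htot : ∀ a b, H.Adj a b → r a b ∨ r b a := fun a b hab =>
    selected_or (p := (a, b)) (Forces.refl hab) rfl fun d h h' => hH a b (h.trans h'.symm)
  have hasymm : ∀ {a b}, r a b → ¬ r b a := fun h => h.not_swap rfl
  have hforce : ∀ {a b c d}, Forces H a b c d → r a b → r c d := fun h hab =>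
    Selected.congr hab (fun _ h' => h.symm.trans h') fun _ h' => h.swap.trans h'
  have htri : ∀ {a b c b' c'}, r a b → r b c → r c a → Forces H b c b' c' →
      Forces H a b a b' ∧ Forces H a c a c' := fun hab hbc hca h =>
    h.triangle (hadj hab) (hadj hca).symm (fun h => hasymm hab (hforce h hbc))
      (fun h => hasymm hca (hforce h hbc))
  have hcyc : ∀ a b c, r a b → r b c → ¬ r c a := by
    intro a b c hab hbc hca
    have wf : WellFounded (WellOrderingRel (α := V)) := IsWellFounded.wf
    -- Take a cyclic triangle with `a` least. The pair `(x, y)` selecting the class of `(c, a)`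
    -- precedes `(a, c)`, so `x ≤ a`. By the triangle lemma `x < a` gives the cyclic triangle `x, y,
    -- b`, and `x = a` gives `r b a`.
    obtain ⟨a, ⟨b, c, hab, hbc, hca⟩, hmin⟩ :=
      wf.has_min {a | ∃ b c, r a b ∧ r b c ∧ r c a} ⟨a, b, c, hab, hbc, hca⟩
    obtain ⟨⟨x, y⟩, hxy, hlt⟩ := id hca
    obtain ⟨h1, h2⟩ := htri hbc hca hab hxy
    have hlt' := hlt (a, c) (Forces.refl (hadj hca).symm)
    have hx : x = a := by
      cases hlt' with
      | left _ _ h =>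
        exact (hmin x ⟨y, b, hforce hxy hca, hforce h2.swap hab, hforce h1 hbc⟩ h).elim
      | right _ h => rfl
    exact hasymm hab (hx ▸ hforce h1 hbc)
  refine ⟨r, fun a b => ⟨htot a b, fun h => h.elim hadj fun h => (hadj h).symm⟩,
    fun a b => hasymm, fun a b c hab hbc => ?_⟩
  have hac : H.Adj a c := not_not.1 fun hac => hasymm hbc
    (hforce ((Forces.refl (hadj hab)).left (hadj hbc).symm hac) hab)
  exact (htot a c hac).resolve_right (hcyc a b c hab hbc)

theorem isComparabilityGraph_iff_forcingConsistent :
    IsComparabilityGraph H ↔ ForcingConsistent H :=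
  ⟨IsComparabilityGraph.forcingConsistent, ForcingConsistent.isComparabilityGraph⟩

/-! ### Odd closed walks in the knotting graph -/

/-- A closed walk of length `N` in Gallai's knotting graph, as an `N`-periodic sequence. -/
def IsKnotCycle (H : SimpleGraph V) (N : ℕ) (w : ℤ → V) : Prop :=
  (∀ j, w (j + N) = w j) ∧ ∀ j, Linked H (w j) (w (j - 1)) (w (j + 1))

/-- Closes up the stretch `f 0, …, f (L - 1)`; `h₀` and `h₁` are the conditions at the seam. -/
theorem exists_isKnotCycle {f : ℤ → V} {L : ℕ} (hL : 2 ≤ L)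
    (h₀ : Linked H (f 0) (f (L - 1)) (f 1)) (h₁ : Linked H (f (L - 1)) (f (L - 2)) (f 0))
    (h : ∀ t : ℤ, 0 < t → t < L - 1 → Linked H (f t) (f (t - 1)) (f (t + 1))) :
    ∃ w, IsKnotCycle H L w := by
  refine ⟨fun t => f (t % L), fun j => by simp, fun j => ?_⟩
  have hL' : (2 : ℤ) ≤ L := by exact_mod_cast hL
  have hnn := Int.emod_nonneg j (b := L) (by omega)
  have hlt := Int.emod_lt_of_pos j (b := L) (by omega)
  have hsucc : (j + 1) % L = if j % L = L - 1 then 0 else j % L + 1 := by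
    rw [Int.add_emod, Int.emod_eq_of_lt (a := 1) (by omega) (by omega)]
    split_ifs with hj
    · rw [hj]; simp
    · exact Int.emod_eq_of_lt (by omega) (by omega)
  have hpred : (j - 1) % L = if j % L = 0 then (L : ℤ) - 1 else j % L - 1 := by
    rw [Int.sub_emod, Int.emod_eq_of_lt (a := 1) (by omega) (by omega)]
    split_ifs with hj
    · rw [hj, ← Int.add_emod_right, Int.emod_eq_of_lt (by omega) (by omega)]; ring
    · exact Int.emod_eq_of_lt (by omega) (by omega)
  simp only [hsucc, hpred]
  generalize j % (L : ℤ) = r at *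
  rcases eq_or_ne r 0 with rfl | h0
  · rw [if_pos rfl, if_neg (by omega), zero_add]
    exact h₀
  rw [if_neg h0]
  split_ifs with h'
  · rw [h', show (L : ℤ) - 1 - 1 = L - 2 by ring]
    exact h₁
  · exact h r (by omega) (by omega)

namespace IsKnotCycle

variable {N : ℕ} {w : ℤ → V}

theorem eq_of_dvd (hw : IsKnotCycle H N w) {i j : ℤ} (h : (N : ℤ) ∣ j - i) : w i = w j := by
  obtain ⟨c, hc⟩ := h
  obtain rfl : j = i + c * N := by linarith
  have hp : Function.Periodic w N := hw.1
  simpa using (hp.int_mul c i).symm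

theorem adj (hw : IsKnotCycle H N w) (j : ℤ) : H.Adj (w j) (w (j + 1)) :=
  (hw.2 j).mem_right

/-- Forcing directs consecutive edges alternately into and out of the vertices of the walk; going
once around an odd cycle reverses an edge. -/
theorem not_forcingConsistent (hw : IsKnotCycle H N w) (hN : Odd N) :
    ¬ ForcingConsistent H := by
  have key : ∀ t : ℕ, Forces H (w 0) (w 1) (w (2 * t)) (w (2 * t + 1)) := by
    intro t
    induction t with
    | zero => simpa using Forces.refl (by simpa using hw.adj 0)
    | succ t ih =>
      have h1 := (hw.2 (2 * t + 1)).forces.swap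
      have h2 := (hw.2 (2 * t + 1 + 1)).forces
      simp only [add_sub_cancel_right] at h1 h2
      convert ih.trans (h1.trans h2) using 2 <;> push_cast <;> ring
  obtain ⟨m, hm⟩ := hN
  intro hc
  have h := key (m + 1)
  have h1 : w 1 = w (2 * (m + 1 : ℕ)) := hw.eq_of_dvd ⟨1, by push_cast [hm]; ring⟩
  have h2 : w 2 = w (2 * (m + 1 : ℕ) + 1) := hw.eq_of_dvd ⟨1, by push_cast [hm]; ring⟩
  rw [← h1, ← h2] at h
  have h' := (hw.2 1).forces
  norm_num at h'
  exact hc _ _ (h.trans h'.symm)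

end IsKnotCycle

/-- The first `n` steps of `u` form a walk in the knotting graph. -/
def IsKnotWalk (H : SimpleGraph V) (n : ℕ) (u : ℕ → V) : Prop :=
  ∀ i, i + 2 ≤ n → Linked H (u (i + 1)) (u i) (u (i + 2))

theorem IsKnotWalk.extend {n : ℕ} {u : ℕ → V} (h : IsKnotWalk H (n + 1) u) {x : V}
    (hx : Linked H (u (n + 1)) (u n) x) :
    ∃ u' : ℕ → V, IsKnotWalk H (n + 2) u' ∧ (∀ i ≤ n + 1, u' i = u i) ∧ u' (n + 2) = x := by
  classical
  refine ⟨fun i => if i ≤ n + 1 then u i else x, fun i hi => ?_, fun i hi => if_pos hi,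
    if_neg (by omega)⟩
  rcases Nat.lt_or_ge n i with h' | h'
  · omega
  · dsimp only
    rw [if_pos (by omega), if_pos (by omega)]
    split_ifs with h2
    · exact h i h2
    · obtain rfl : i = n := by omega
      exact hx

/-- Each forcing step contributes two steps of the walk, one of them a trivial turn back, so parity
is kept and the last edge is traversed from `d` to `c`. -/
theorem Forces.exists_isKnotWalk {a b c d : V} (h : Forces H a b c d) :
    ∃ (n : ℕ) (u : ℕ → V), IsKnotWalk H (2 * n + 2) u ∧ u 0 = a ∧ u 1 = b ∧
      u (2 * n + 1) = d ∧ u (2 * n + 2) = c := by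
  have step : ∀ {n : ℕ} {u : ℕ → V} {x y : V}, IsKnotWalk H (2 * n + 2) u →
      Linked H (u (2 * n + 2)) (u (2 * n + 1)) x → Linked H x (u (2 * n + 2)) y →
      ∃ u' : ℕ → V, IsKnotWalk H (2 * (n + 1) + 2) u' ∧ u' 0 = u 0 ∧ u' 1 = u 1 ∧
        u' (2 * (n + 1) + 1) = x ∧ u' (2 * (n + 1) + 2) = y := by
    intro n u x y hu hx hy
    obtain ⟨u₁, h1, h2, h3⟩ := hu.extend hx
    obtain ⟨u₂, h4, h5, h6⟩ := h1.extend (x := y) (by rwa [h3, h2 _ (by omega)])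
    refine ⟨u₂, h4, ?_, ?_, ?_, h6⟩
    · rw [h5 _ (by omega), h2 _ (by omega)]
    · rw [h5 _ (by omega), h2 _ (by omega)]
    · rw [← h3, ← h5 _ (by omega)]; rfl
  induction h with
  | refl h =>
    refine ⟨0, fun i => if i = 1 then b else a, fun i hi => ?_, rfl, rfl, rfl, rfl⟩
    obtain rfl : i = 0 := by omega
    exact .refl h.symm
  | @right c d d' h0 h1 h2 ih =>
    obtain ⟨n, u, hu, ha, hb, hd, hc⟩ := ih
    obtain ⟨u', h⟩ := step (x := d') (y := c) hu
      (by rw [hd, hc]; exact .single h0.adj_right h2 h1) (by rw [hc]; exact .refl h1.symm)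
    exact ⟨n + 1, u', by rwa [ha, hb] at h⟩
  | @left c c' d h0 h1 h2 ih =>
    obtain ⟨n, u, hu, ha, hb, hd, hc⟩ := ih
    obtain ⟨u', h⟩ := step (x := d) (y := c') hu
      (by rw [hd, hc]; exact .refl h0.adj_right)
      (by rw [hc]; exact .single h0.adj_right.symm h2 h1.symm)
    exact ⟨n + 1, u', by rwa [ha, hb] at h⟩

theorem exists_odd_isKnotCycle (hH : ¬ ForcingConsistent H) :
    ∃ N w, Odd N ∧ IsKnotCycle H N w := by
  simp only [ForcingConsistent, not_forall, not_not] at hH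
  obtain ⟨a, b, h⟩ := hH
  obtain ⟨n, u, hu, ha, hb, hd, hc⟩ := h.exists_isKnotWalk
  rcases n.eq_zero_or_pos with rfl | hn
  · exact (h.adj_left.ne (hd.symm.trans hb)).elim
  obtain ⟨n, rfl⟩ : ∃ m, n = m + 1 := ⟨n - 1, by omega⟩
  -- The walk begins and ends with the step from `a` to `b`; identifying these two steps leaves an
  -- odd closed walk.
  obtain ⟨w, hw⟩ : ∃ w, IsKnotCycle H (2 * (n + 1) + 1) w := by
    refine exists_isKnotCycle (f := fun t => u t.toNat) (by omega) ?_ ?_ ?_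
    · have := hu (2 * n + 2) (by omega)
      have e : ((2 * (n + 1) + 1 : ℕ) - 1 : ℤ).toNat = 2 * n + 2 := by omega
      rw [e, Int.toNat_zero, Int.toNat_one, ha, hb]
      convert this
      · exact hd.symm
      · exact hc.symm
    · have := hu (2 * n + 1) (by omega)
      have e : ((2 * (n + 1) + 1 : ℕ) - 1 : ℤ).toNat = 2 * n + 2 := by omega
      have e' : ((2 * (n + 1) + 1 : ℕ) - 2 : ℤ).toNat = 2 * n + 1 := by omega
      rw [e, e', Int.toNat_zero, ha]
      convert this
      exact hd.symm
    · intro t h1 h2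
      have := hu (t - 1).toNat (by omega)
      convert this using 2 <;> omega
  exact ⟨_, w, ⟨n + 1, rfl⟩, hw⟩

end Bigraph

/-! ### Shortest odd closed walks visit distinct vertices -/

namespace Bigraph

variable {V : Type*} {H : SimpleGraph V}

namespace IsKnotCycle

variable {N : ℕ} {w : ℤ → V}

theorem one_lt (hw : IsKnotCycle H N w) (hN : Odd N) : 1 < N := by
  rcases hN with ⟨_ | m, rfl⟩
  · exact ((hw.adj 0).ne (hw.eq_of_dvd (by simp))).elim
  · omega

theorem not_dvd_four (hw : IsKnotCycle H N w) (hN : Odd N) : ¬ (N : ℤ) ∣ 4 := by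
  intro h
  have h : N ∣ 4 := by exact_mod_cast h
  have := Nat.le_of_dvd (by omega) h
  have := hw.one_lt hN
  obtain ⟨m, rfl⟩ := hN
  obtain rfl : m = 1 := by omega
  omega

/-- A shortest odd closed walk in the knotting graph has no chords. -/
theorem chordless (hw : IsKnotCycle H N w) (hN : Odd N)
    (hmin : ∀ L < N, Odd L → ∀ w', ¬ IsKnotCycle H L w') {i j : ℤ}
    (hi : Linked H (w i) (w (i + 1)) (w j)) (hj : Linked H (w j) (w (j + 1)) (w i)) :
    (N : ℤ) ∣ j - i - 1 ∨ (N : ℤ) ∣ j - i + 1 := by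
  have hN1 := hw.one_lt hN
  have hd0 := Int.emod_nonneg (j - i) (b := N) (by omega)
  have hdN := Int.emod_lt_of_pos (j - i) (b := N) (by omega)
  have hdvd : (N : ℤ) ∣ (j - i) - (j - i) % N := Int.dvd_self_sub_emod
  generalize (j - i) % (N : ℤ) = d at *
  rcases eq_or_ne d 0 with rfl | h0
  · rw [← hw.eq_of_dvd (i := i) (j := j) (by simpa using hdvd)] at hi
    exact (hi.mem_right.ne rfl).elim
  rcases eq_or_ne d 1 with rfl | h1
  · exact Or.inl hdvd
  rcases eq_or_ne d (N - 1) with rfl | h2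
  · refine Or.inr ?_
    have := dvd_add hdvd (dvd_refl (N : ℤ))
    ring_nf at this ⊢
    exact this
  exfalso
  rw [← hw.eq_of_dvd (i := i + d) (j := j) (by convert hdvd using 1; ring)] at hi hj
  rw [← hw.eq_of_dvd (i := i + d + 1) (j := j + 1) (by convert hdvd using 1; ring)] at hj
  lift d to ℕ using hd0
  -- The chord cuts the closed walk in two; the arc with an even number of steps, completed by the
  -- chord, is a shorter odd closed walk.
  rcases Nat.even_or_odd d with he | ho
  · obtain ⟨w', hw'⟩ : ∃ w', IsKnotCycle H (d + 1) w' := by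
      refine exists_isKnotCycle (f := fun t => w (i + t)) (by omega) ?_ ?_ ?_
      · simpa using hi.symm
      · have := (hw.2 (i + d)).trans hj
        push_cast
        convert this using 2 <;> ring
      · intro t _ _
        have := hw.2 (i + t)
        convert this using 2 <;> ring
    exact hmin _ (by omega) he.add_one _ hw'
  · obtain ⟨e, he⟩ : ∃ e : ℕ, N = d + e := ⟨N - d, by omega⟩
    have heo : Even e := by
      rw [he] at hN
      exact (Nat.odd_add.1 hN).1 ho
    have hwi : w (i + d + e) = w i := by
      rw [← hw.1 i, he]; push_cast; ring_nf
    have hwi' : w (i + d + (e - 1)) = w (i - 1) := by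
      rw [← hw.1 (i - 1), he]; push_cast; ring_nf
    obtain ⟨w', hw'⟩ : ∃ w', IsKnotCycle H (e + 1) w' := by
      refine exists_isKnotCycle (f := fun t => w (i + d + t)) (by omega) ?_ ?_ ?_
      · push_cast
        rw [add_zero, add_sub_cancel_right, hwi]
        exact hj.symm
      · have := (hw.2 i).trans hi
        push_cast
        rw [add_zero, add_sub_cancel_right, hwi, show (e : ℤ) + 1 - 2 = e - 1 by ring, hwi']
        exact this
      · intro t _ _
        have := hw.2 (i + d + t)
        convert this using 2 <;> ring
    exact hmin _ (by omega) heo.add_one _ hw'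

end IsKnotCycle

/-- `t` is adjacent in the complement of `H` to all neighbours of the set `A` there that lie
outside `A`. -/
def DominatesBoundary (H : SimpleGraph V) (A : Set V) (t : V) : Prop :=
  ∀ z ∉ A, ∀ a ∈ A, ¬ H.Adj z a → ¬ H.Adj t z

/-- A path in the complement leaving the common neighbours of `A` would have to enter the boundary
of `A`, all of which is non-adjacent to `t`. -/
theorem DominatesBoundary.coJoined {A : Set V} {t x y : V} (ht : DominatesBoundary H A t)
    (hx : ∀ a ∈ A, H.Adj x a) (h : Linked H t x y) : CoJoined H {u | ∀ a ∈ A, H.Adj u a} x y := by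
  induction h with
  | refl _ => exact .refl hx
  | @tail y z _ h1 h2 ih =>
    exact ih.tail h1 fun a ha => not_not.1 fun hza =>
      ht z (fun hz => h1 (ih.mem_right z hz)) a ha hza h2

/-- Some boundary vertex `z` is a neighbour of `c`; the route from `b` through `z` into the
component stays among the neighbours of `c`. -/
theorem linked_of_not_dominatesBoundary {v x b c a : V}
    (hc : ∀ u, Linked H v x u → H.Adj c u) (hc' : ¬ DominatesBoundary H {u | Linked H v x u} c)
    (hb : DominatesBoundary H {u | Linked H v x u} b) (hcb : H.Adj c b) (ha : Linked H v x a) :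
    Linked H c b a := by
  simp only [DominatesBoundary, not_forall, not_not] at hc'
  obtain ⟨z, hz, a₀, ha₀, hza, hcz⟩ := hc'
  have h := (CoJoined.within ha₀).symm.trans ha.within
  exact ((CoJoined.single hcb (hb z hz a₀ ha₀ hza) hcz).tail hza (hc a₀ ha₀)).trans
    (h.mono fun u hu => hc u hu)

theorem dominatesBoundary_self {v x : V} : DominatesBoundary H {u | Linked H v x u} v :=
  fun _ hz _ ha hza hvz => hz (CoJoined.tail ha (fun h => hza h.symm) hvz)

namespace IsKnotCycle

variable {N : ℕ} {w : ℤ → V}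

/-- If `w (q + 1)` dominated the boundary of `A`, domination would spread along the walk, until
either the walk enters `A` while staying complete to `A`, or a chord appears. -/
theorem not_dominatesBoundary (hw : IsKnotCycle H N w) (hN : Odd N)
    (hmin : ∀ L < N, Odd L → ∀ w', ¬ IsKnotCycle H L w') {p q : ℤ} (hpq : w p = w q)
    (hlink : ¬ Linked H (w p) (w (p + 1)) (w (q + 1))) :
    ¬ DominatesBoundary H {u | Linked H (w p) (w (p + 1)) u} (w (q + 1)) := by
  intro hb
  have hN1 := hw.one_lt hN
  have hN4 := hw.not_dvd_four hN
  set A : Set V := {u | Linked H (w p) (w (p + 1)) u} with hA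
  set R : Set V := {u | ∀ a ∈ A, H.Adj u a} with hR
  have hvR : w p ∈ R := fun a ha => CoJoined.mem_right ha
  have hvdom : DominatesBoundary H A (w p) := dominatesBoundary_self
  have hbR : w (q + 1) ∈ R := fun a ha => not_not.1 fun h =>
    hlink (CoJoined.tail ha (fun h' => h h'.symm) (hpq ▸ hw.adj q))
  have hsucc : w (p + 1) ∈ A := CoJoined.refl (hw.adj p)
  have hpred : w (p - 1) ∈ A := (hw.2 p).symm
  have hRA : ∀ a ∈ A, R ⊆ H.neighborSet a := fun a ha u hu => (hu a ha).symm
  -- If `w j` failed to dominate, position `j` would have chords to both `p + 1` and `p - 1`, whence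
  -- `N ∣ 4`.
  have key : ∀ j, CoJoined H R (w p) (w j) → DominatesBoundary H A (w (j - 1)) →
      DominatesBoundary H A (w j) := by
    intro j hj hdom
    by_contra hnd
    have hlinked : ∀ a ∈ A, Linked H (w j) (w (j + 1)) a := fun a ha =>
      (hw.2 j).symm.trans
        (linked_of_not_dominatesBoundary hj.mem_right hnd hdom (hw.2 j).mem_left ha)
    have h1 := hw.2 (p + 1)
    rw [add_sub_cancel_right] at h1
    have h2 := hw.chordless hN hmin (h1.symm.trans (hj.mono (hRA _ hsucc))) (hlinked _ hsucc)
    have h3 := hw.chordless hN hmin (i := p - 1) (j := j)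
      (by rw [sub_add_cancel]; exact hj.mono (hRA _ hpred)) (hlinked _ hpred)
    have h0 : ¬ (N : ℤ) ∣ j - p := fun h => hnd (hw.eq_of_dvd h ▸ hvdom)
    have h2' : (N : ℤ) ∣ j - p - 2 := by
      rcases h2 with h | h
      · exact h.trans (dvd_of_eq (by ring))
      · exact (h0 (h.trans (dvd_of_eq (by ring)))).elim
    have h3' : (N : ℤ) ∣ j - p + 2 := by
      rcases h3 with h | h
      · exact (h0 (h.trans (dvd_of_eq (by ring)))).elim
      · exact h.trans (dvd_of_eq (by ring))
    exact hN4 ((dvd_sub h3' h2').trans (dvd_of_eq (by ring)))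
  have hstep : ∀ j, w j ∈ R → DominatesBoundary H A (w (j + 1)) →
      CoJoined H R (w j) (w (j + 2)) := fun j hj hdom => by
    have h := hw.2 (j + 1)
    rw [add_sub_cancel_right, show j + 1 + 1 = j + 2 by ring] at h
    exact hdom.coJoined hj h
  have hq2 : CoJoined H R (w p) (w (q + 2)) := by
    rw [hpq] at hvR ⊢
    exact hstep q hvR hb
  have hq2dom : DominatesBoundary H A (w (q + 2)) :=
    key _ hq2 (by rwa [show q + 2 - 1 = q + 1 by ring])
  have hq3 : CoJoined H R (w (q + 1)) (w (q + 3)) := by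
    have := hstep (q + 1) hbR (by rwa [show q + 1 + 1 = q + 2 by ring])
    rwa [show q + 1 + 2 = q + 3 by ring] at this
  -- Within one component of `R`, the induction runs around the whole cycle and puts `w (p + 1)`, a
  -- vertex of `A`, into `R`. Across two components, which are completely adjacent in `H`, there is
  -- a chord from `q` to `q + 3`.
  by_cases hcon : CoJoined H R (w p) (w (q + 1))
  · have hall : ∀ t : ℕ, (CoJoined H R (w p) (w (q + t)) ∧ DominatesBoundary H A (w (q + t))) ∧
        (CoJoined H R (w p) (w (q + t + 1)) ∧ DominatesBoundary H A (w (q + t + 1))) := by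
      intro t
      induction t with
      | zero =>
        simp only [Nat.cast_zero, add_zero]
        exact ⟨⟨hpq ▸ .refl hvR, hpq ▸ hvdom⟩, hcon, hb⟩
      | succ t ih =>
        obtain ⟨⟨h1, h2⟩, h3, h4⟩ := ih
        have h5 := h1.trans (hstep _ h1.mem_right h4)
        have h6 := key _ h5 (by rwa [show q + (t : ℤ) + 2 - 1 = q + t + 1 by ring])
        have e : q + ((t + 1 : ℕ) : ℤ) = q + t + 1 := by push_cast; ring
        rw [e, show q + (t : ℤ) + 1 + 1 = q + t + 2 by ring]
        exact ⟨⟨h3, h4⟩, h5, h6⟩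
    have ht0 := Int.emod_nonneg (p + 1 - q) (b := N) (by omega)
    have hdvd : (N : ℤ) ∣ (p + 1 - q) - (p + 1 - q) % N := Int.dvd_self_sub_emod
    generalize (p + 1 - q) % (N : ℤ) = t at *
    lift t to ℕ using ht0
    have h := (hall t).1.1.mem_right
    rw [hw.eq_of_dvd (i := q + t) (j := p + 1) (by convert hdvd using 1; ring)] at h
    exact (h _ hsucc).ne rfl
  · have h1 : Linked H (w q) (w (q + 1)) (w (q + 3)) := by
      refine hq3.within.mono fun u hu => not_not.1 fun hvu => hcon ?_
      rw [← hpq] at hvu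
      exact (CoJoined.single hvR hvu hu.mem_right).trans hu.symm
    have h2 : Linked H (w (q + 3)) (w (q + 2)) (w q) := by
      rw [← hpq]
      refine hq2.within.symm.mono fun u hu => not_not.1 fun hdu => hcon ?_
      exact (CoJoined.tail hu (fun h => hdu h.symm) hq3.mem_right).trans hq3.symm
    have h3 := hw.2 (q + 3)
    rw [show q + 3 - 1 = q + 2 by ring] at h3
    rcases hw.chordless hN hmin h1 (h3.symm.trans h2) with h | h
    · exact hN4 ((h.trans (dvd_of_eq (by ring) : _ ∣ (2 : ℤ))).trans (by norm_num))
    · exact hN4 (h.trans (dvd_of_eq (by ring)))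

/-- A shortest odd closed walk in the knotting graph passes through distinct vertices of the
graph. -/
theorem dvd_sub_of_eq (hw : IsKnotCycle H N w) (hN : Odd N)
    (hmin : ∀ L < N, Odd L → ∀ w', ¬ IsKnotCycle H L w') {p q : ℤ} (hpq : w p = w q) :
    (N : ℤ) ∣ q - p := by
  by_contra hnd
  have hN4 := hw.not_dvd_four hN
  -- With equal components, `p` would be joined to both `q + 1` and `q - 1`; for `p`, `q`
  -- incongruent modulo `N` this again gives `N ∣ 4`.
  have hlink : ¬ Linked H (w p) (w (p + 1)) (w (q + 1)) := by
    intro h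
    have h1 := hw.2 (q + 1)
    have h2 := hw.2 (q - 1)
    rw [add_sub_cancel_right] at h1
    rw [sub_add_cancel] at h2
    have h3 := h.trans (hpq ▸ (hw.2 q).symm)
    have c1 := hw.chordless hN hmin h (hpq ▸ h1.symm)
    have c2 := hw.chordless hN hmin h3
      (by rw [sub_add_cancel, hpq]; exact .refl h2.mem_right)
    have c1' : (N : ℤ) ∣ q - p + 2 := by
      rcases c1 with h | h
      · exact (hnd (h.trans (dvd_of_eq (by ring)))).elim
      · exact h.trans (dvd_of_eq (by ring))
    have c2' : (N : ℤ) ∣ q - p - 2 := by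
      rcases c2 with h | h
      · exact h.trans (dvd_of_eq (by ring))
      · exact (hnd (h.trans (dvd_of_eq (by ring)))).elim
    exact hN4 ((dvd_sub c1' c2').trans (dvd_of_eq (by ring)))
  have hlink' : ¬ Linked H (w q) (w (q + 1)) (w (p + 1)) := fun h => hlink (hpq ▸ h.symm)
  have hadj : ∀ {i j : ℤ}, w i = w j → ¬ Linked H (w i) (w (i + 1)) (w (j + 1)) →
      ∀ u, Linked H (w i) (w (i + 1)) u → H.Adj (w (j + 1)) u := fun {i j} hij h u hu =>
    not_not.1 fun h' => h (CoJoined.tail hu (fun h => h' h.symm) (hij ▸ hw.adj j))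
  have hl : ∀ {i j : ℤ}, w i = w j → ¬ Linked H (w i) (w (i + 1)) (w (j + 1)) →
      Linked H (w (j + 1)) (w (j + 1 + 1)) (w (i + 1)) := fun {i j} hij h => by
    have h1 := hw.2 (j + 1)
    rw [add_sub_cancel_right] at h1
    refine h1.symm.trans ?_
    rw [← hij]
    exact linked_of_not_dominatesBoundary (hadj hij h) (hw.not_dominatesBoundary hN hmin hij h)
      dominatesBoundary_self (hij ▸ (hw.adj j).symm) (.refl (hw.adj i))
  -- With different components, `p + 1` and `q + 1` are joined, so `w p = w q` would be an
  -- `H`-neighbour of itself.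
  rcases hw.chordless hN hmin (hl hpq.symm hlink') (hl hpq hlink) with h | h
  · exact (hw.adj p).ne (hpq.trans (hw.eq_of_dvd (h.trans (dvd_of_eq (by ring)))).symm)
  · refine (hw.adj (p - 1)).ne ?_
    rw [sub_add_cancel, hpq]
    exact hw.eq_of_dvd (h.trans (dvd_of_eq (by ring)))

end IsKnotCycle

theorem exists_odd_isKnotCycle_injective (hH : ¬ ForcingConsistent H) :
    ∃ N w, Odd N ∧ IsKnotCycle H N w ∧ ∀ p q, w p = w q → (N : ℤ) ∣ q - p := by
  classical
  have hex : ∃ N, Odd N ∧ ∃ w, IsKnotCycle H N w := by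
    obtain ⟨N, w, h1, h2⟩ := exists_odd_isKnotCycle hH
    exact ⟨N, h1, w, h2⟩
  obtain ⟨hN, w, hw⟩ := Nat.find_spec hex
  exact ⟨_, w, hN, hw, fun p q => hw.dvd_sub_of_eq hN fun L hL hLo w' hw' =>
    Nat.find_min hex hL ⟨hLo, w', hw'⟩⟩

/-! ### Asteroids as odd closed walks -/

/-- An asteroid of the complement of `H` whose vertices need not be distinct, in terms of linked
vertices. -/
def IsWeakAsteroid (H : SimpleGraph V) (k : ℕ) (v : ZMod (2 * k + 1) → V) : Prop :=
  ∀ i, Linked H (v i) (v (i + k)) (v (i + k + 1))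

theorem two_mul_natCast_add_one_eq_zero (k : ℕ) : (2 : ZMod (2 * k + 1)) * k + 1 = 0 := by
  exact_mod_cast ZMod.natCast_self (2 * k + 1)

theorem exists_isWeakAsteroid_injective (hH : ¬ ForcingConsistent H) :
    ∃ k v, Function.Injective v ∧ IsWeakAsteroid H k v := by
  obtain ⟨N, w, ⟨k, rfl⟩, hw, hinj⟩ := exists_odd_isKnotCycle_injective hH
  have hk := two_mul_natCast_add_one_eq_zero k
  have heq : ∀ {a b : ℤ}, (a : ZMod (2 * k + 1)) = b → w a = w b := fun h =>
    hw.eq_of_dvd ((ZMod.intCast_eq_intCast_iff_dvd_sub _ _ _).1 h)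
  -- Since `2k ≡ -1`, doubling sends `i + k` and `i + k + 1` to `2i - 1` and `2i + 1`.
  refine ⟨k, fun i => w (2 * (i.cast : ℤ)), fun i j h => ?_, fun i => ?_⟩
  · have h := (ZMod.intCast_eq_intCast_iff_dvd_sub _ _ _).2 (hinj _ _ h)
    push_cast [ZMod.intCast_zmod_cast] at h
    linear_combination (-(k : ZMod (2 * k + 1))) * h + (i - j) * hk
  · have h := hw.2 (2 * (i.cast : ℤ))
    have h1 : w (2 * ((i + k : ZMod (2 * k + 1)).cast : ℤ)) = w (2 * (i.cast : ℤ) - 1) := by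
      apply heq
      push_cast [ZMod.intCast_zmod_cast]
      linear_combination hk
    have h2 : w (2 * ((i + k + 1 : ZMod (2 * k + 1)).cast : ℤ)) = w (2 * (i.cast : ℤ) + 1) := by
      apply heq
      push_cast [ZMod.intCast_zmod_cast]
      linear_combination hk
    dsimp only
    rwa [h1, h2]

theorem IsWeakAsteroid.not_forcingConsistent {k : ℕ} {v : ZMod (2 * k + 1) → V}
    (hv : IsWeakAsteroid H k v) : ¬ ForcingConsistent H := by
  have hk := two_mul_natCast_add_one_eq_zero k
  -- `k + 1` is the inverse of `2` modulo `2k + 1`.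
  refine IsKnotCycle.not_forcingConsistent (N := 2 * k + 1)
    (w := fun j => v ((j * (k + 1) : ℤ) : ZMod (2 * k + 1))) ⟨fun j => ?_, fun j => ?_⟩ ⟨k, rfl⟩
  · dsimp only
    congr 1
    push_cast
    linear_combination (k + 1 : ZMod (2 * k + 1)) * hk
  · dsimp only
    convert hv ((j * (k + 1) : ℤ) : ZMod (2 * k + 1)) using 2
    · push_cast
      linear_combination -hk
    · push_cast
      ring

theorem IsWeakAsteroid.pos {k : ℕ} {v : ZMod (2 * k + 1) → V} (hv : IsWeakAsteroid H k v) :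
    1 ≤ k := by
  by_contra hk
  obtain rfl : k = 0 := by omega
  have := (hv 0).mem_left
  simp at this

/-- The condition `a ≠ v` keeps the whole path off `v`: the vertex before `v` would be a neighbour
of `v`. -/
theorem linked_iff_exists_path {a b v : V} :
    Linked H v a b ↔ a ≠ v ∧ ∃ p : Hᶜ.Walk a b, p.IsPath ∧ ∀ u ∈ p.support, ¬ Hᶜ.Adj v u := by
  classical
  constructor
  · intro h
    refine ⟨h.mem_left.ne', ?_⟩
    suffices ∃ p : Hᶜ.Walk a b, ∀ u ∈ p.support, H.Adj v u by
      obtain ⟨p, hp⟩ := this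
      exact ⟨p.bypass, p.bypass_isPath, fun u hu h => h.2 (hp u (p.support_bypass_subset_support hu))⟩
    induction h with
    | refl h => exact ⟨.nil, by simpa using h⟩
    | @tail y z _ h1 h2 ih =>
      obtain ⟨p, hp⟩ := ih
      rcases eq_or_ne y z with rfl | hyz
      · exact ⟨p, hp⟩
      · refine ⟨p.concat ⟨hyz, h1⟩, fun u hu => ?_⟩
        rw [SimpleGraph.Walk.support_concat] at hu
        simp only [List.mem_append, List.mem_singleton] at hu
        rcases hu with hu | rfl
        · exact hp u hu
        · exact h2
  · rintro ⟨hav, p, -, hp⟩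
    have hadj : ∀ {x}, x ≠ v → ¬ Hᶜ.Adj v x → H.Adj v x := fun hx h =>
      not_not.1 fun h' => h ⟨hx.symm, h'⟩
    induction p with
    | nil => exact .refl (hadj hav (hp _ (by simp)))
    | @cons a c b hac p ih =>
      have ha := hp a (by simp)
      have hcv : c ≠ v := fun h => ha (h ▸ hac.symm)
      have h := ih hcv fun u hu => hp u (by simp [hu])
      exact (CoJoined.single (hadj hav ha) hac.2 h.mem_left).trans h

theorem hasAsteroid_compl_iff :
    HasAsteroid Hᶜ ↔ ∃ k v, Function.Injective v ∧ IsWeakAsteroid H k v := by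
  constructor
  · rintro ⟨k, hk, v, hv, h⟩
    refine ⟨k, v, hv, fun i => linked_iff_exists_path.2 ⟨fun e => ?_, h i⟩⟩
    have h0 := hv e
    rw [add_eq_left, ZMod.natCast_eq_zero_iff] at h0
    have := Nat.le_of_dvd (by omega) h0
    omega
  · rintro ⟨k, v, hv, h⟩
    exact ⟨k, IsWeakAsteroid.pos h, v, hv, fun i => (linked_iff_exists_path.1 (h i)).2⟩

end Bigraph

/-! ### Edge-asteroids as asteroids of the independence graph -/

namespace Bigraph

variable {V : Type*} {G : SimpleGraph V} {X Y : Set V}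

/-- Disjointness is automatic: a shared end would be adjacent to the other end of its edge. -/
theorem independent_of_not_adj {e f : Sym2 V} (he : e ∈ G.edgeSet) (hf : f ∈ G.edgeSet)
    (h : ∀ a ∈ e, ∀ b ∈ f, ¬ G.Adj a b) : Independent G e f := by
  refine ⟨he, hf, fun a ha b hb => ⟨?_, h a ha b hb⟩⟩
  rintro rfl
  obtain ⟨c, rfl⟩ := hb
  exact h a ha c (Sym2.mem_mk_right _ _) hf

/-- There is a walk from `a` to `b` inside `S`. -/
def WalkWithin (G : SimpleGraph V) (S : Set V) (a b : V) : Prop :=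
  ∃ p : G.Walk a b, ∀ u ∈ p.support, u ∈ S

theorem WalkWithin.trans {S : Set V} {a b c : V} (h : WalkWithin G S a b)
    (h' : WalkWithin G S b c) : WalkWithin G S a c := by
  obtain ⟨p, hp⟩ := h
  obtain ⟨q, hq⟩ := h'
  refine ⟨p.append q, fun u hu => ?_⟩
  rcases SimpleGraph.Walk.mem_support_append_iff _ _ |>.1 hu with h | h
  · exact hp u h
  · exact hq u h

theorem WalkWithin.of_eq_or_adj {S : Set V} {a b : V} (ha : a ∈ S) (hb : b ∈ S)
    (h : a = b ∨ G.Adj a b) : WalkWithin G S a b := by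
  rcases h with rfl | h
  · exact ⟨.nil, by simpa using ha⟩
  · exact ⟨h.toWalk, by simp [ha, hb]⟩

theorem WalkWithin.of_mem_edge {S : Set V} {e : Sym2 V} (he : e ∈ G.edgeSet)
    (hS : ∀ a ∈ e, a ∈ S) {a b : V} (ha : a ∈ e) (hb : b ∈ e) : WalkWithin G S a b := by
  refine .of_eq_or_adj (hS a ha) (hS b hb) ?_
  rcases eq_or_ne a b with h | h
  · exact Or.inl h
  · obtain rfl := (Sym2.mem_and_mem_iff h).1 ⟨ha, hb⟩
    exact Or.inr he

/-- Edges non-adjacent in `I(G)` share an end or are joined by an edge, so a chain of them carries a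
walk; conversely consecutive edges of a walk share an end. -/
theorem linked_independenceGraph_iff {d e f : G.edgeSet} :
    Linked (independenceGraph G) d e f ↔ EdgesJoinedAvoiding G e f d := by
  set S : Set V := {u | ∀ w ∈ (d : Sym2 V), ¬ G.Adj u w} with hS
  have hmem : ∀ {g : G.edgeSet}, (independenceGraph G).Adj d g → ∀ a ∈ (g : Sym2 V), a ∈ S :=
    fun hg a ha w hw h => (hg.2.2 w hw a ha).2 h.symm
  have hadj : ∀ {g : G.edgeSet}, (∀ a ∈ (g : Sym2 V), a ∈ S) → (independenceGraph G).Adj d g :=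
    fun {g} hg => independent_of_not_adj d.2 g.2 fun a ha b hb h => hg b hb a ha h.symm
  constructor
  · intro h
    have key : ∀ a ∈ (e : Sym2 V), ∀ b ∈ (f : Sym2 V), WalkWithin G S a b := by
      induction h with
      | refl h => exact fun a ha b hb => .of_mem_edge e.2 (hmem h) ha hb
      | @tail g g' h0 h1 h2 ih =>
        intro a ha b hb
        have hg := hmem h0.mem_right
        obtain ⟨x, hx, y, hy, hxy⟩ : ∃ x ∈ (g : Sym2 V), ∃ y ∈ (g' : Sym2 V),
            x = y ∨ G.Adj x y := by
          by_contra hcon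
          refine h1 ⟨g.2, g'.2, fun x hx y hy => ?_⟩
          exact ⟨fun h => hcon ⟨x, hx, y, hy, Or.inl h⟩, fun h => hcon ⟨x, hx, y, hy, Or.inr h⟩⟩
        exact ((ih a ha x hx).trans (.of_eq_or_adj (hg x hx) (hmem h2 y hy) hxy)).trans
          (.of_mem_edge g'.2 (hmem h2) hy hb)
    have he := hmem h.mem_left
    have hf := hmem h.mem_right
    obtain ⟨e, heG⟩ := e
    obtain ⟨f, hfG⟩ := f
    induction e with | _ a a'
    induction f with | _ b b'
    have hends : ∀ {x y : V}, x ∈ s(x, y) ∧ y ∈ s(x, y) := by simp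
    obtain ⟨p, hp⟩ := WalkWithin.of_mem_edge heG he hends.1 hends.2
    obtain ⟨q, hq⟩ := key a' hends.2 b hends.1
    obtain ⟨r, hr⟩ := WalkWithin.of_mem_edge hfG hf hends.1 hends.2
    refine ⟨a, hends.1, b', hends.2, (p.append q).append r, ?_, ?_, ?_⟩
    · intro u hu
      simp only [Sym2.mem_iff] at hu
      rcases hu with rfl | rfl <;> simp [SimpleGraph.Walk.mem_support_append_iff]
    · intro u hu
      simp only [Sym2.mem_iff] at hu
      rcases hu with rfl | rfl <;> simp [SimpleGraph.Walk.mem_support_append_iff]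
    · intro u hu
      simp only [SimpleGraph.Walk.mem_support_append_iff] at hu
      rcases hu with (hu | hu) | hu
      · exact hp u hu
      · exact hq u hu
      · exact hr u hu
  · rintro ⟨a, ha, b, hb, p, he, hf, hp⟩
    have he' := hadj fun u hu => hp u (he u hu)
    have hf' := hadj fun u hu => hp u (hf u hu)
    clear he hf
    have hshare : ∀ {g g' : G.edgeSet} {x : V}, x ∈ (g : Sym2 V) → x ∈ (g' : Sym2 V) →
        ¬ (independenceGraph G).Adj g g' := fun h h' hi => (hi.2.2 _ h _ h').1 rfl
    induction p generalizing e with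
    | nil => exact .single he' (hshare ha hb) hf'
    | @cons x y z hxy p ih =>
      have hg : (independenceGraph G).Adj d ⟨s(x, y), hxy⟩ := hadj fun u hu => hp u <| by
        simp only [Sym2.mem_iff] at hu
        rcases hu with rfl | rfl <;> simp
      have hstep : Linked (independenceGraph G) d e ⟨s(x, y), hxy⟩ :=
        .single he' (hshare ha (Sym2.mem_mk_left x y)) hg
      exact hstep.trans
        (ih (Sym2.mem_mk_right x y) hb (fun u hu => hp u (by simp [hu])) hg)

theorem hasWeakEdgeAsteroid_iff :
    HasWeakEdgeAsteroid G ↔ ∃ k v, IsWeakAsteroid (independenceGraph G) k v := by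
  constructor
  · rintro ⟨k, e, he, h⟩
    exact ⟨k, fun i => ⟨e i, he i⟩, fun i => linked_independenceGraph_iff.2 (h i)⟩
  · rintro ⟨k, v, h⟩
    exact ⟨k, fun i => v i, fun i => (v i).2, fun i => linked_independenceGraph_iff.1 (h i)⟩

theorem hasEdgeAsteroid_iff :
    HasEdgeAsteroid G ↔
      ∃ k v, Function.Injective v ∧ IsWeakAsteroid (independenceGraph G) k v := by
  constructor
  · rintro ⟨k, e, hinj, he, h⟩
    exact ⟨k, fun i => ⟨e i, he i⟩, fun i j hij => hinj (congrArg Subtype.val hij),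
      fun i => linked_independenceGraph_iff.2 (h i)⟩
  · rintro ⟨k, v, hinj, h⟩
    exact ⟨k, fun i => v i, Subtype.val_injective.comp hinj, fun i => (v i).2,
      fun i => linked_independenceGraph_iff.1 (h i)⟩

/-! ### Invertible pairs -/

/-- There are walks of equal length from `u` to `x` and from `v` to `y` whose corresponding edges
are independent. -/
inductive PairReach (G : SimpleGraph V) : V → V → V → V → Prop
  | refl (u v : V) : PairReach G u v u v
  | head {u v u' v' x y : V} : Independent G s(u, u') s(v, v') → PairReach G u' v' x y →
      PairReach G u v x y

namespace PairReach

variable {a b c d e f : V}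

theorem trans (h : PairReach G a b c d) (h' : PairReach G c d e f) : PairReach G a b e f := by
  induction h with
  | refl _ _ => exact h'
  | head h1 _ ih => exact head h1 (ih h')

theorem single (h : Independent G s(a, c) s(b, d)) : PairReach G a b c d :=
  head h (refl c d)

theorem symm (h : PairReach G a b c d) : PairReach G c d a b := by
  induction h with
  | refl _ _ => exact refl _ _
  | @head u v u' v' _ _ h1 _ ih =>
    exact ih.trans (single (by rwa [Sym2.eq_swap, Sym2.eq_swap (a := v')]))

theorem swap (h : PairReach G a b c d) : PairReach G b a d c := by
  induction h with
  | refl _ _ => exact refl _ _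
  | head h1 _ ih => exact head h1.symm ih

theorem exists_walks (h : PairReach G a b c d) :
    ∃ (W : G.Walk a c) (W' : G.Walk b d), W.length = W'.length ∧ ∀ i < W.length,
      Independent G s(W.getVert i, W.getVert (i + 1)) s(W'.getVert i, W'.getVert (i + 1)) := by
  induction h with
  | refl _ _ => exact ⟨.nil, .nil, rfl, by simp⟩
  | head h1 _ ih =>
    obtain ⟨W, W', hlen, hind⟩ := ih
    have hu : G.Adj _ _ := h1.1
    have hv : G.Adj _ _ := h1.2.1
    refine ⟨.cons hu W, .cons hv W', by simp [hlen], fun i hi => ?_⟩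
    cases i with
    | zero => simpa using h1
    | succ i => simpa using hind i (by simpa using hi)

theorem of_walks (W : G.Walk a c) (W' : G.Walk b d) (hlen : W.length = W'.length)
    (h : ∀ i < W.length,
      Independent G s(W.getVert i, W.getVert (i + 1)) s(W'.getVert i, W'.getVert (i + 1))) :
    PairReach G a b c d := by
  induction W generalizing b with
  | nil =>
    cases W' with
    | nil => exact refl _ _
    | cons _ _ => simp at hlen
  | cons hW W ih =>
    cases W' with
    | nil => simp at hlen
    | cons hW' W' =>
      refine head (by simpa using h 0 (by simp)) (ih W' (by simpa using hlen) fun i hi => ?_)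
      simpa using h (i + 1) (by simpa using hi)

end PairReach

theorem hasInvertiblePair_iff :
    HasInvertiblePair G X Y ↔ ∃ u v, u ≠ v ∧ SamePart X Y u v ∧ PairReach G u v v u := by
  constructor
  · rintro ⟨u, v, huv, W, W', hpart, hlen, h⟩
    exact ⟨u, v, huv, hpart, .of_walks W W' hlen h⟩
  · rintro ⟨u, v, huv, hpart, h⟩
    obtain ⟨W, W', hlen, h⟩ := h.exists_walks
    exact ⟨u, v, huv, W, W', hpart, hlen, h⟩

theorem SamePart.not_adj (hG : G.IsBipartiteWith X Y) {a b : V} (h : SamePart X Y a b) :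
    ¬ G.Adj a b := by
  intro hab
  have hd := Set.disjoint_left.1 hG.disjoint
  rcases h with h | h <;> rcases hG.mem_of_adj hab with h' | h'
  · exact hd h.2 h'.2
  · exact hd h.1 h'.1
  · exact hd h'.1 h.1
  · exact hd h'.2 h.2

theorem SamePart.of_adj (hG : G.IsBipartiteWith X Y) {a b a' b' : V} (h : SamePart X Y a b)
    (ha : G.Adj a a') (hb : G.Adj b b') : SamePart X Y a' b' := by
  have hd := Set.disjoint_left.1 hG.disjoint
  rcases hG.mem_of_adj ha with ha | ha <;> rcases hG.mem_of_adj hb with hb | hb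
  · exact Or.inr ⟨ha.2, hb.2⟩
  · rcases h with h | h
    · exact (hd h.2 hb.1).elim
    · exact (hd ha.1 h.1).elim
  · rcases h with h | h
    · exact (hd h.1 ha.1).elim
    · exact (hd hb.1 h.2).elim
  · exact Or.inl ⟨ha.2, hb.2⟩

theorem SamePart.symm {a b : V} (h : SamePart X Y a b) : SamePart X Y b a :=
  h.imp And.symm And.symm

/-- The edges `e` and `bb'` are also independent, so forcing can replace `f` by `bb'` and then `e`
by `aa'`. -/
theorem forces_of_independent (hG : G.IsBipartiteWith X Y) {a b a' b' : V}
    (hab : SamePart X Y a b) {e f : G.edgeSet} (ha : a ∈ (e : Sym2 V)) (hb : b ∈ (f : Sym2 V))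
    (hef : Independent G e f) (h : Independent G s(a, a') s(b, b')) :
    Forces (independenceGraph G) e f ⟨s(a, a'), h.1⟩ ⟨s(b, b'), h.2.1⟩ := by
  have hmid : (independenceGraph G).Adj e ⟨s(b, b'), h.2.1⟩ := by
    refine independent_of_not_adj e.2 h.2.1 fun x hx y hy => ?_
    obtain ⟨x', hx'⟩ := ha
    have hax : G.Adj a x' := by
      have := e.2
      rwa [hx'] at this
    rw [hx'] at hx
    simp only [Sym2.mem_iff] at hx hy
    rcases hx with rfl | rfl <;> rcases hy with rfl | rfl
    · exact hab.not_adj hG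
    · exact (h.2.2 _ (Sym2.mem_mk_left _ _) _ (Sym2.mem_mk_right _ _)).2
    · exact (hef.2.2 _ (hx' ▸ Sym2.mem_mk_right _ _) _ hb).2
    · exact (hab.of_adj hG hax h.2.1).not_adj hG
  refine ((Forces.refl hef).right hmid fun hi => ?_).left h fun hi => ?_
  · exact (hi.2.2 b hb b (Sym2.mem_mk_left _ _)).1 rfl
  · exact (hi.2.2 a ha a (Sym2.mem_mk_left _ _)).1 rfl

theorem PairReach.exists_forces (hG : G.IsBipartiteWith X Y) {a b c d : V}
    (h : PairReach G a b c d) (hab : SamePart X Y a b) {e f : G.edgeSet} (ha : a ∈ (e : Sym2 V))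
    (hb : b ∈ (f : Sym2 V)) (hef : Independent G e f) :
    ∃ e' f' : G.edgeSet, c ∈ (e' : Sym2 V) ∧ d ∈ (f' : Sym2 V) ∧
      Forces (independenceGraph G) e f e' f' := by
  induction h generalizing e f with
  | refl _ _ => exact ⟨e, f, ha, hb, .refl hef⟩
  | head h1 _ ih =>
    obtain ⟨e', f', hc, hd, h⟩ := ih (hab.of_adj hG h1.1 h1.2.1) (e := ⟨_, h1.1⟩)
      (f := ⟨_, h1.2.1⟩) (Sym2.mem_mk_right _ _) (Sym2.mem_mk_right _ _) h1
    exact ⟨e', f', hc, hd, (forces_of_independent hG hab ha hb hef h1).trans h⟩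

theorem ForcingConsistent.not_hasInvertiblePair (hG : G.IsBipartiteWith X Y)
    (h : ForcingConsistent (independenceGraph G)) : ¬ HasInvertiblePair G X Y := by
  rw [hasInvertiblePair_iff]
  rintro ⟨u, v, huv, hpart, hreach⟩
  obtain ⟨u', v', hind⟩ : ∃ u' v', Independent G s(u, u') s(v, v') := by
    cases hreach with
    | refl _ _ => exact (huv rfl).elim
    | head h1 _ => exact ⟨_, _, h1⟩
  obtain ⟨e, f, he, hf, hforce⟩ := hreach.exists_forces hG hpart (e := ⟨_, hind.1⟩)
    (f := ⟨_, hind.2.1⟩) (Sym2.mem_mk_left _ _) (Sym2.mem_mk_left _ _) hind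
  -- The pair `e`, `f` now contains `v`, `u`; one more replacement reaches the initial pair
  -- reversed.
  exact h _ _ (hforce.trans
    (forces_of_independent hG hpart.symm he hf hforce.adj_right hind.symm))

/-! ### T-free orientations -/

theorem isBipartiteWith_bipartiteComplement (hG : G.IsBipartiteWith X Y) :
    (bipartiteComplement G X Y).IsBipartiteWith X Y :=
  ⟨hG.disjoint, fun _ _ h => h.2.1⟩

/-- On four vertices, bipartite complementation exchanges the two perfect matchings. -/
theorem independent_bipartiteComplement_iff (hG : G.IsBipartiteWith X Y) {x x' y y' : V}
    (hx : x ∈ X) (hx' : x' ∈ X) (hy : y ∈ Y) (hy' : y' ∈ Y) :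
    Independent (bipartiteComplement G X Y) s(x, y) s(x', y') ↔
      Independent G s(x, y') s(x', y) := by
  have hd : ∀ {a b}, a ∈ X → b ∈ Y → a ≠ b := fun ha hb h =>
    Set.disjoint_left.1 hG.disjoint ha (h ▸ hb)
  have hadj : ∀ {a b}, a ∈ X → b ∈ Y →
      ((bipartiteComplement G X Y).Adj a b ↔ ¬ G.Adj a b) := fun ha hb =>
    ⟨fun h => h.2.2, fun h => ⟨hd ha hb, Or.inl ⟨ha, hb⟩, h⟩⟩
  rw [independent_mk_iff (isBipartiteWith_bipartiteComplement hG) hx hx' hy hy',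
    independent_mk_iff hG hx hx' hy' hy, hadj hx hy, hadj hx' hy', hadj hx hy', hadj hx' hy,
    ne_comm (a := y)]
  tauto

theorem hasTFreeOrientation_of_not_hasInvertiblePair (hG : G.IsBipartiteWith X Y)
    (h : ¬ HasInvertiblePair G X Y) : HasTFreeOrientation G X Y := by
  rw [hasInvertiblePair_iff] at h
  let R : V × V → V × V → Prop := fun p q => PairReach G p.1 p.2 q.1 q.2
  let S : V → V → Prop := fun a b => Selected WellOrderingRel R Prod.swap (a, b)
  have hasymm : ∀ {a b}, S a b → ¬ S b a := fun h => h.not_swap rfl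
  have hreach : ∀ {a b c d}, PairReach G a b c d → S a b → S c d := fun h hab =>
    Selected.congr hab (fun _ h' => h.symm.trans h') fun _ h' => h.swap.trans h'
  refine ⟨fun a b => a ≠ b ∧ SamePart X Y a b ∧ S a b, ⟨?_, ?_, ?_⟩, ?_⟩
  · exact fun a b hab => ⟨⟨hab.1, hab.2.1.not_adj hG⟩, hab.2.1⟩
  · intro a b hab hpart
    refine (selected_or (lt := WellOrderingRel) (R := R) (s := Prod.swap) (p := (a, b))
      (.refl a b) rfl fun d h1 h2 => h ⟨a, b, hab.1, hpart, h1.trans h2.symm⟩).imp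
      (fun h => ⟨hab.1, hpart, h⟩) fun h => ⟨hab.1.symm, hpart.symm, h⟩
  · exact fun a b h h' => hasymm h.2.2 h'.2.2
  · intro x hx x' hx' y hy y' hy' hind
    rw [independent_bipartiteComplement_iff hG hx hx' hy hy'] at hind
    rintro (⟨h1, h2⟩ | ⟨h1, h2⟩)
    -- `hind` takes `(x, x')` to `(y', y)` in one step, so selecting `x → x'` selects `y' → y`.
    · exact hasymm h2.2.2 (hreach (.single hind) h1.2.2)
    · exact hasymm h2.2.2 (hreach (.single hind.symm) h1.2.2)

theorem HasTFreeOrientation.forcingConsistent (hG : G.IsBipartiteWith X Y)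
    (h : HasTFreeOrientation G X Y) : ForcingConsistent (independenceGraph G) := by
  obtain ⟨arc, harc, hT⟩ := h
  have hends : ∀ e : G.edgeSet, ∃ x y, x ∈ X ∧ y ∈ Y ∧ (e : Sym2 V) = s(x, y) := by
    rintro ⟨e, he⟩
    induction e with | _ a b
    rcases hG.mem_of_adj he with h | h
    · exact ⟨a, b, h.1, h.2, rfl⟩
    · exact ⟨b, a, h.2, h.1, Sym2.eq_swap⟩
  choose fx fy hfx hfy hf using hends
  have htot : ∀ {a b}, a ≠ b → SamePart X Y a b → arc a b ∨ arc b a := fun hab hp =>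
    harc.oriented _ _ ⟨hab, hp.not_adj hG⟩ hp
  have htotX : ∀ {x x' y y'}, x ∈ X → x' ∈ X → y ∈ Y → y' ∈ Y →
      Independent G s(x, y) s(x', y') → arc x x' ∨ arc x' x := fun hx hx' hy hy' h =>
    htot ((independent_mk_iff hG hx hx' hy hy').1 h).2.2.1 (Or.inl ⟨hx, hx'⟩)
  -- For independent edges, T-freeness makes the arcs on the `X`-ends and the `Y`-ends agree.
  have key : ∀ {x x' y y'}, x ∈ X → x' ∈ X → y ∈ Y → y' ∈ Y →
      Independent G s(x, y) s(x', y') → (arc x x' ↔ arc y y') := by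
    intro x x' y y' hx hx' hy hy' h
    have h1 := htotX hx hx' hy hy' h
    have h2 := htot ((independent_mk_iff hG hx hx' hy hy').1 h).2.2.2.1 (Or.inr ⟨hy, hy'⟩)
    have h3 := hT x hx x' hx' y' hy' y hy
      ((independent_bipartiteComplement_iff hG hx hx' hy' hy).2 h)
    have h4 := harc.asymm x x'
    have h5 := harc.asymm y y'
    tauto
  refine .of_orientation (r := fun e f => arc (fx e) (fx f)) (fun e f hef => ?_)
    (fun e f _ => harc.asymm _ _) fun e f g hef heg hfg h => ?_
  · change Independent G e f at hef
    rw [hf e, hf f] at hef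
    exact htotX (hfx e) (hfx f) (hfy e) (hfy f) hef
  · change Independent G e f at hef
    change Independent G e g at heg
    change ¬ Independent G f g at hfg
    have hfG := f.2
    have hgG := g.2
    rw [hf e, hf f] at hef
    rw [hf e, hf g] at heg
    rw [hf f] at hfG
    rw [hf g] at hgG
    rw [hf f, hf g, independent_mk_iff hG (hfx f) (hfx g) (hfy f) (hfy g)] at hfg
    have hyy := (key (hfx e) (hfx f) (hfy e) (hfy f) hef).1 h
    have hcase : fx f = fx g ∨ fy f = fy g ∨ G.Adj (fx f) (fy g) ∨ G.Adj (fx g) (fy f) := by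
      rw [SimpleGraph.mem_edgeSet] at hfG hgG
      tauto
    have i1 := (independent_mk_iff hG (hfx e) (hfx f) (hfy e) (hfy f)).1 hef
    have i2 := (independent_mk_iff hG (hfx e) (hfx g) (hfy e) (hfy g)).1 heg
    rcases hcase with h' | h' | h' | h'
    · rwa [← h']
    · exact (key (hfx e) (hfx g) (hfy e) (hfy g) heg).2 (h' ▸ hyy)
    -- The edge joining `f` to `g` is itself independent of `e`, and carries the direction from `f`
    -- over to `g`.
    · have hind : Independent G s(fx e, fy e) s(fx f, fy g) :=
        (independent_mk_iff hG (hfx e) (hfx f) (hfy e) (hfy g)).2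
          ⟨i1.1, h', i1.2.2.1, i2.2.2.2.1, i2.2.2.2.2.1, i1.2.2.2.2.2⟩
      exact (key (hfx e) (hfx g) (hfy e) (hfy g) heg).2
        ((key (hfx e) (hfx f) (hfy e) (hfy g) hind).1 h)
    · have hind : Independent G s(fx e, fy e) s(fx g, fy f) :=
        (independent_mk_iff hG (hfx e) (hfx g) (hfy e) (hfy f)).2
          ⟨i1.1, h', i2.2.2.1, i1.2.2.2.1, i1.2.2.2.2.1, i2.2.2.2.2.2⟩
      exact (key (hfx e) (hfx g) (hfy e) (hfy f) hind).2 hyy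

end Bigraph

theorem theorem2p7 {V : Type*} [Finite V] (G : SimpleGraph V) (X Y : Set V)
    (hG : G.IsBipartiteWith X Y) (hXY : X ∪ Y = Set.univ) :
    List.TFAE
      [Bigraph.IsComparabilityGraph (Bigraph.independenceGraph G),
       Bigraph.HasTFreeOrientation G X Y,
       ¬ Bigraph.HasInvertiblePair G X Y,
       ¬ Bigraph.HasWeakEdgeAsteroid G,
       ¬ Bigraph.HasEdgeAsteroid G,
       ¬ Bigraph.HasAsteroid (Bigraph.independenceGraph G)ᶜ] := by
  rw [Bigraph.isComparabilityGraph_iff_forcingConsistent, Bigraph.hasWeakEdgeAsteroid_iff,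
    Bigraph.hasEdgeAsteroid_iff, Bigraph.hasAsteroid_compl_iff]
  tfae_have 2 → 1 := fun h => h.forcingConsistent hG
  tfae_have 1 → 3 := fun h => h.not_hasInvertiblePair hG
  tfae_have 3 → 2 := Bigraph.hasTFreeOrientation_of_not_hasInvertiblePair hG
  tfae_have 1 → 4 := fun h ⟨_, _, hv⟩ => hv.not_forcingConsistent h
  tfae_have 4 → 5 := fun h ⟨k, v, _, hv⟩ => h ⟨k, v, hv⟩
  -- After the rewriting, both statements exclude the same injective families.
  tfae_have 5 → 6 := id
  tfae_have 6 → 1 := fun h => not_not.1 fun hc => h (Bigraph.exists_isWeakAsteroid_injective hc)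
  tfae_finish
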